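/- Let $\mathcal M\subset\mathcal B(\mathcal H)$ be a von Neumann algebra on a complex Hilbert space, equipped with a normal semifinite faithful trace $tr$. Let $a\neq 0$ be a $tr$-measurable operator, i.e. a closed, densely defined operator on $\mathcal H$, affiliated with $\mathcal M$, such that $tr(e_{|a|}(t,\infty))<\infty$ for some $t>0$, where $e_{|a|}$ denotes the spectral measure of $|a|=(a^*a)^{1/2}$. Let $$\lambda_a(s)=tr(e_{|a|}(s,\infty))\in[0,\infty]\quad(s\ge 0),\qquad \mu_a(t)=\inf\{s\geq 0:\lambda_a(s)\leq t\}\quad(t>0)$$ be its distribution function and its non-increasing rearrangement, and define its order of infinite at $0$ and its order of infinitesimal at $\infty$ by $$\mathrm{ord}_0(a)=\liminf_{t\to0^+}\frac{\log\mu_a(t)}{\log(1/t)},\qquad \mathrm{ord}_\infty(a)=\liminf_{t\to\infty}\frac{\log\mu_a(t)}{\log(1/t)} .$$ Then, as elements of the extended real line, with the conventions $\log 0=-\infty$, $\log\infty=\infty$, $0^{-1}=\infty$, $\infty^{-1}=0$, $$\mathrm{ord}_0(a)=\left(\limsup_{s\to\infty}\frac{\log\lambda_a(s)}{\log(1/s)}\right)^{-1},\qquad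 \mathrm{ord}_\infty(a)=\left(\limsup_{s\to0^{+}}\frac{\log\lambda_a(s)}{\log(1/s)}\right)^{-1}.$$ -/

import Mathlib

open Filter Topology
open scoped ENNReal NNReal

set_option linter.unusedSectionVars false

noncomputable section

namespace TauMeasurable

variable {H : Type*} [NormedAddCommGroup H] [InnerProductSpace ℂ H] [CompleteSpace H]

/-- A normal semifinite faithful trace on (the positive cone of) a von Neumann algebra `M`
acting on `H`. Only the values of `toFun` on the positive cone
`{x | x ∈ M ∧ 0 ≤ x}` (Loewner order) are meaningful. -/
structure NSFTrace (M : VonNeumannAlgebra H) where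
  /-- the trace, with values in `[0, ∞]` -/
  toFun : (H →L[ℂ] H) → ℝ≥0∞
  map_add' : ∀ x ∈ M, ∀ y ∈ M, 0 ≤ x → 0 ≤ y → toFun (x + y) = toFun x + toFun y
  /-- positive homogeneity, with `0 * ∞ = 0` -/
  map_smul' : ∀ (c : ℝ≥0), ∀ x ∈ M, 0 ≤ x → toFun (((c : ℝ) : ℂ) • x) = (c : ℝ≥0∞) * toFun x
  tracial' : ∀ x ∈ M, toFun (star x * x) = toFun (x * star x)
  /-- faithfulness -/
  faithful' : ∀ x ∈ M, 0 ≤ x → toFun x = 0 → x = 0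
  /-- normality: suprema of increasing nets of positive elements are preserved -/
  normal' : ∀ S : Set (H →L[ℂ] H), S.Nonempty → (∀ y ∈ S, y ∈ M ∧ 0 ≤ y) →
    DirectedOn (· ≤ ·) S → ∀ x ∈ M, IsLUB S x → toFun x = ⨆ y ∈ S, toFun y
  /-- semifiniteness: every nonzero positive element dominates a nonzero positive element
  of finite trace -/
  semifinite' : ∀ x ∈ M, 0 ≤ x → x ≠ 0 → ∃ y ∈ M, 0 ≤ y ∧ y ≤ x ∧ y ≠ 0 ∧ toFun y < ⊤

instance (M : VonNeumannAlgebra H) : CoeFun (NSFTrace M) fun _ => (H →L[ℂ] H) → ℝ≥0∞ :=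
  ⟨NSFTrace.toFun⟩

/-- The operator `a` is affiliated with `M`: `y a ⊆ a y` for every `y` in the commutant of `M`. -/
def IsAffiliated (M : VonNeumannAlgebra H) (a : H →ₗ.[ℂ] H) : Prop :=
  ∀ y ∈ M.commutant, ∀ x : a.domain, ∃ h : y (x : H) ∈ a.domain, a ⟨y x, h⟩ = y (a x)

/-- The closure of the graph of `a`, as a closed subspace of the Hilbert sum `H ⊕ H`. -/
def hilbertGraph (a : H →ₗ.[ℂ] H) : Submodule ℂ (WithLp 2 (H × H)) :=
  (a.graph.comap (WithLp.linearEquiv 2 ℂ (H × H)).toLinearMap).topologicalClosure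

instance (a : H →ₗ.[ℂ] H) : CompleteSpace (hilbertGraph a) :=
  Submodule.topologicalClosure.completeSpace _

/-- The bounded operator `(1 + a* a)⁻¹ = (1 + |a|²)⁻¹` for a closed densely defined operator `a`,
built as the upper left corner of the orthogonal projection of `H ⊕ H` onto the graph of `a`.
By `resolventSq_spec` it is a right inverse of the injective operator `1 + a* a`. -/
def resolventSq (a : H →ₗ.[ℂ] H) : H →L[ℂ] H :=
  (WithLp.fstL 2 ℂ H H) ∘L (hilbertGraph a).starProjection ∘L
    ((WithLp.prodContinuousLinearEquiv 2 ℂ H H).symm : H × H →L[ℂ] WithLp 2 (H × H)) ∘L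
    (ContinuousLinearMap.inl ℂ H H)

/-- The spectral projection `1_{(0, ∞)}(b)` of a bounded self-adjoint operator `b`: the
orthogonal projection onto the closure of the range of the positive part `b⁺`. -/
def posSpectralProj (b : H →L[ℂ] H) : H →L[ℂ] H :=
  (b⁺.range.topologicalClosure).starProjection

/-- The spectral projection `e_{|a|}(t, ∞)`, `t ≥ 0`, of the absolute value `|a| = (a* a)^{1/2}`
of a closed densely defined operator `a`.  As `|a| > t` if and only if
`(1 + |a|²)⁻¹ < (1 + t²)⁻¹`, it is `1_{(0, ∞)}((1 + t²)⁻¹ - (1 + a* a)⁻¹)`. -/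
def absSpectralProj (a : H →ₗ.[ℂ] H) (t : ℝ≥0) : H →L[ℂ] H :=
  posSpectralProj ((((1 + (t : ℝ) ^ 2)⁻¹ : ℝ) : ℂ) • (1 : H →L[ℂ] H) - resolventSq a)

variable {M : VonNeumannAlgebra H}

/-- The distribution function `λ_a(t) = tr (e_{|a|}(t, ∞))`. -/
def distribution (tr : NSFTrace M) (a : H →ₗ.[ℂ] H) (t : ℝ≥0) : ℝ≥0∞ :=
  tr (absSpectralProj a t)

/-- `a` belongs to the algebra of `tr`-measurable operators: it is closed, densely defined,
affiliated with `M`, and `tr (e_{|a|}(t, ∞)) < ∞` for some `t > 0`. -/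
structure IsMeasurableOp (tr : NSFTrace M) (a : H →ₗ.[ℂ] H) : Prop where
  closed : a.IsClosed
  dense : Dense (a.domain : Set H)
  affiliated : IsAffiliated M a
  finite : ∃ t : ℝ≥0, 0 < t ∧ distribution tr a t < ⊤

/-- The non-increasing rearrangement `μ_a(t) = inf {s ≥ 0 : λ_a(s) ≤ t}`. -/
def rearrangement (tr : NSFTrace M) (a : H →ₗ.[ℂ] H) (t : ℝ≥0) : ℝ≥0∞ :=
  ⨅ (s : ℝ≥0) (_ : distribution tr a s ≤ (t : ℝ≥0∞)), (s : ℝ≥0∞)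

/-- The quotient `log y / log (1 / x)` with `log 0 = -∞`, `log ∞ = ∞`. It is only
considered for `x` near `0` or near `∞`. -/
def logRatio (y : ℝ≥0∞) (x : ℝ≥0) : EReal :=
  ENNReal.log y / ((Real.log (1 / (x : ℝ)) : ℝ) : EReal)

/-- Order of infinite of `a` at `0`. -/
def orderZero (tr : NSFTrace M) (a : H →ₗ.[ℂ] H) : EReal :=
  liminf (fun t : ℝ≥0 => logRatio (rearrangement tr a t) t) (𝓝[>] 0)

/-- Order of infinitesimal of `a` at `∞`. -/
def orderInfty (tr : NSFTrace M) (a : H →ₗ.[ℂ] H) : EReal :=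
  liminf (fun t : ℝ≥0 => logRatio (rearrangement tr a t) t) atTop

/-- The reciprocal in the extended reals with `1 / 0 = ∞` and `1 / (±∞) = 0`
(Mathlib's `0⁻¹` is `0`). -/
def recip (x : EReal) : EReal := if x = 0 then ⊤ else x⁻¹

/-! ### Verification that the constructed operators are the intended ones -/

theorem mem_hilbertGraph {a : H →ₗ.[ℂ] H} (ha : a.IsClosed) (z : WithLp 2 (H × H)) :
    z ∈ hilbertGraph a ↔ (z.fst, z.snd) ∈ a.graph := by
  have hc : IsClosed ((a.graph.comap (WithLp.linearEquiv 2 ℂ (H × H)).toLinearMap :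
      Submodule ℂ (WithLp 2 (H × H))) : Set (WithLp 2 (H × H))) :=
    IsClosed.preimage (WithLp.prodContinuousLinearEquiv 2 ℂ H H).continuous ha
  rw [hilbertGraph, hc.submodule_topologicalClosure_eq]
  rfl

/-- `(1 + a* a) (1 + a* a)⁻¹ x = x`. -/
theorem resolventSq_spec {a : H →ₗ.[ℂ] H} (ha : a.IsClosed) (hd : Dense (a.domain : Set H))
    (x : H) :
    ∃ (h : resolventSq a x ∈ a.domain) (h' : a ⟨resolventSq a x, h⟩ ∈ a.adjoint.domain),
      resolventSq a x + a.adjoint ⟨a ⟨resolventSq a x, h⟩, h'⟩ = x := by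
  set z : WithLp 2 (H × H) := WithLp.toLp 2 (x, 0) with hz
  set p := (hilbertGraph a).starProjection z with hp
  have hR : resolventSq a x = p.fst := rfl
  have hpm : (p.fst, p.snd) ∈ a.graph :=
    (mem_hilbertGraph ha p).1 (Submodule.starProjection_apply_mem _ _)
  obtain ⟨h, hv⟩ : ∃ h : p.fst ∈ a.domain, a ⟨p.fst, h⟩ = p.snd := by
    obtain ⟨y, hy1, hy2⟩ := (LinearPMap.mem_graph_iff a).1 hpm
    have h1 : p.fst = (y : H) := hy1.symm
    exact ⟨h1 ▸ y.2, by rw [← show a y = p.snd from hy2]; congr 1; exact Subtype.ext h1⟩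
  have key : ∀ y : a.domain, inner ℂ (x - p.fst) (y : H) = inner ℂ p.snd (a y) := by
    intro y
    have hy : (WithLp.toLp 2 ((y : H), a y) : WithLp 2 (H × H)) ∈ hilbertGraph a :=
      (mem_hilbertGraph ha _).2 (a.mem_graph y)
    have h0 := Submodule.starProjection_inner_eq_zero (K := hilbertGraph a) z _ hy
    rw [← hp, WithLp.prod_inner_apply] at h0
    simp only [hz, WithLp.ofLp_sub, Prod.fst_sub, Prod.snd_sub, zero_sub, inner_neg_left] at h0
    exact sub_eq_zero.1 (by rw [sub_eq_add_neg]; exact h0)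
  have hmem : p.snd ∈ a.adjoint.domain :=
    LinearPMap.mem_adjoint_domain_of_exists _ ⟨x - p.fst, key⟩
  rw [hR]
  refine ⟨h, hv ▸ hmem, ?_⟩
  rw [LinearPMap.adjoint_apply_eq hd _ (x₀ := x - p.fst) (fun y => (key y).trans (congrArg (inner ℂ · (a y)) hv.symm))]
  abel

theorem inner_resolventSq (a : H →ₗ.[ℂ] H) (x y : H) :
    inner ℂ (resolventSq a x) y = inner ℂ x (resolventSq a y) := by
  have h := Submodule.starProjection_isSymmetric (K := hilbertGraph a)
    (WithLp.toLp 2 (x, 0)) (WithLp.toLp 2 (y, 0))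
  simpa [WithLp.prod_inner_apply, resolventSq] using h

/-- `absSpectralProj a t` commutes with `(1 + |a|²)⁻¹`, one has `|a| ≤ t` on its kernel and
`|a| > t` on its range; so it is the spectral projection of `|a|` for `(t, ∞)`. -/
theorem absSpectralProj_spec {a : H →ₗ.[ℂ] H} (ha : a.IsClosed)
    (hd : Dense (a.domain : Set H)) (t : ℝ≥0) :
    IsStarProjection (absSpectralProj a t) ∧
    Commute (absSpectralProj a t) (resolventSq a) ∧
    (∀ x, absSpectralProj a t x = 0 → ∃ h : x ∈ a.domain, ‖a ⟨x, h⟩‖ ≤ t * ‖x‖) ∧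
    (∀ x : a.domain, absSpectralProj a t x = x → (x : H) ≠ 0 → t * ‖(x : H)‖ < ‖a x‖) := by
  set c : ℝ := (1 + (t : ℝ) ^ 2)⁻¹ with hc
  have hc0 : 0 < c := by positivity
  set R := resolventSq a with hR
  set b : H →L[ℂ] H := (c : ℂ) • (1 : H →L[ℂ] H) - R with hb
  have hPdef : absSpectralProj a t = (b⁺.range.topologicalClosure).starProjection := rfl
  have hRsa : IsSelfAdjoint R :=
    (ContinuousLinearMap.isSelfAdjoint_iff_isSymmetric).2 (inner_resolventSq a)
  have hbsa : IsSelfAdjoint b := by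
    refine IsSelfAdjoint.sub (IsSelfAdjoint.smul ?_ (IsSelfAdjoint.one _)) hRsa
    simp [IsSelfAdjoint]
  have hbd : b⁺ - b⁻ = b := CFC.posPart_sub_negPart b hbsa
  have hp := (ContinuousLinearMap.nonneg_iff_isPositive _).1 (CFC.posPart_nonneg b)
  have hn := (ContinuousLinearMap.nonneg_iff_isPositive _).1 (CFC.negPart_nonneg b)
  have hpn : ∀ x, b⁺ (b⁻ x) = 0 := fun x => congrArg (· x) (CFC.posPart_mul_negPart b)
  have hnp : ∀ x, b⁻ (b⁺ x) = 0 := fun x => congrArg (· x) (CFC.negPart_mul_posPart b)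
  have hRx : ∀ x, R x = (c : ℂ) • x - b⁺ x + b⁻ x := by
    intro x
    have h1 : (b⁺ - b⁻) x = b x := by rw [hbd]
    have h2 : b x = (c : ℂ) • x - R x := rfl
    rw [h2] at h1
    rw [sub_add, ← sub_apply, h1]
    abel
  have hker : ∀ x, absSpectralProj a t x = 0 ↔ b⁺ x = 0 := by
    intro x
    rw [hPdef, Submodule.starProjection_apply_eq_zero_iff, Submodule.orthogonal_closure,
      Submodule.mem_orthogonal]
    constructor
    · intro h
      have := h (b⁺ (b⁺ x)) ⟨_, rfl⟩
      rw [hp.inner_left_eq_inner_right] at this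
      exact inner_self_eq_zero.1 this
    · rintro h _ ⟨y, rfl⟩
      change inner ℂ (b⁺ y) x = 0
      rw [hp.inner_left_eq_inner_right, h, inner_zero_right]
  have hran : ∀ x, absSpectralProj a t x = x → b⁻ x = 0 := by
    intro x hx
    rw [hPdef, Submodule.starProjection_eq_self_iff] at hx
    have hle : b⁺.range.topologicalClosure ≤ b⁻.ker := by
      refine Submodule.topologicalClosure_minimal _ ?_ b⁻.isClosed_ker
      rintro _ ⟨y, rfl⟩
      exact hnp y
    exact hle hx
  have hP : IsStarProjection (absSpectralProj a t) := isStarProjection_starProjection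
  have hinv : ∀ x, absSpectralProj a t (R (absSpectralProj a t x)) =
      R (absSpectralProj a t x) := by
    intro x
    rw [hPdef, Submodule.starProjection_eq_self_iff]
    have hle : b⁺.range.topologicalClosure ≤
        (b⁺.range.topologicalClosure).comap (R : H →ₗ[ℂ] H) := by
      refine Submodule.topologicalClosure_minimal _ ?_
        (b⁺.range.isClosed_topologicalClosure.preimage R.continuous)
      rintro _ ⟨y, rfl⟩
      refine Submodule.le_topologicalClosure _ ⟨(c : ℂ) • y - b⁺ y, ?_⟩
      change b⁺ _ = R (b⁺ y)
      rw [hRx, hnp]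
      simp
    exact hle (Submodule.starProjection_apply_mem _ _)
  have hcomm : Commute (absSpectralProj a t) R := by
    have h1 : absSpectralProj a t * (R * absSpectralProj a t) = R * absSpectralProj a t :=
      ContinuousLinearMap.ext hinv
    have h2 := congrArg star h1
    simp only [star_mul, hP.isSelfAdjoint.star_eq, hRsa.star_eq] at h2
    rw [mul_assoc, h1] at h2
    exact h2.symm
  refine ⟨hP, hcomm, ?_, ?_⟩
  · intro x hx
    rw [hker] at hx
    set T : H →L[ℂ] H := (c : ℂ) • (1 : H →L[ℂ] H) + b⁻ with hT
    have hTu : IsUnit T := by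
      refine ContinuousLinearMap.isUnit_of_forall_le_norm_inner_map T (c := ⟨c, hc0.le⟩) hc0 ?_
      intro y
      have h1 := hn.re_inner_nonneg_left y
      refine le_trans ?_ (RCLike.re_le_norm _)
      simp only [hT, add_apply, smul_apply,
        one_apply_eq_self, inner_add_left, inner_smul_left, map_add,
        Complex.conj_ofReal]
      have h2 : RCLike.re ((c : ℂ) * inner ℂ y y) = c * ‖y‖ ^ 2 := by
        rw [← inner_self_eq_norm_sq (𝕜 := ℂ)]; simp
      rw [h2]
      change ‖y‖ ^ 2 * c ≤ _
      linarith
    obtain ⟨S, hS1, hS2⟩ : ∃ S : H →L[ℂ] H, S * T = 1 ∧ T * S = 1 := by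
      obtain ⟨u, hu⟩ := hTu
      exact ⟨(u⁻¹ : (H →L[ℂ] H)ˣ), by rw [← hu]; simp, by rw [← hu]; simp⟩
    set y := S x with hy
    have hTy : T y = x := DFunLike.congr_fun hS2 x
    have hTy' : (c : ℂ) • y + b⁻ y = x := hTy
    have hby : b⁺ y = 0 := by
      have h1 : T (b⁺ y) = 0 := by
        have h3 : T (b⁺ y) = (c : ℂ) • b⁺ y + b⁻ (b⁺ y) := rfl
        have h4 : b⁺ ((c : ℂ) • y + b⁻ y) = b⁺ x := by rw [hTy']
        rw [map_add, hpn, hx, map_smul] at h4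
        rw [h3, hnp, h4]
      have h2 : S (T (b⁺ y)) = b⁺ y := DFunLike.congr_fun hS1 (b⁺ y)
      rw [← h2, h1, map_zero]
    have hRy : R y = x := by rw [hRx, hby, sub_zero, hTy']
    obtain ⟨h, h', he⟩ := resolventSq_spec ha hd y
    have hRy' : resolventSq a y = x := hRy
    simp only [hRy'] at h he h'
    refine ⟨h, ?_⟩
    have h1 := LinearPMap.adjoint_isFormalAdjoint hd ⟨a ⟨x, h⟩, h'⟩ ⟨x, h⟩
    rw [← eq_sub_iff_add_eq'] at he
    rw [he] at h1
    have h2 : RCLike.re (inner ℂ (y - x) x) = ‖a ⟨x, h⟩‖ ^ 2 := by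
      have h5 : inner ℂ (y - x) x = inner ℂ (a ⟨x, h⟩) (a ⟨x, h⟩) := h1
      rw [h5, inner_self_eq_norm_sq]
    have h3 : 0 ≤ RCLike.re (inner ℂ (x - (c : ℂ) • y) x) := by
      have h6 : x - (c : ℂ) • y = b⁻ y := by rw [← hTy']; abel
      rw [h6]
      conv_rhs => rw [← hTy']
      rw [inner_add_right, inner_smul_right, map_add]
      have h7 : RCLike.re ((c : ℂ) * inner ℂ (b⁻ y) y) = c * RCLike.re (inner ℂ (b⁻ y) y) := by
        simp
      rw [h7]
      have h8 := hn.re_inner_nonneg_left y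
      have h9 : 0 ≤ RCLike.re (inner ℂ (b⁻ y) (b⁻ y)) := inner_self_nonneg
      positivity
    rw [inner_sub_left, inner_smul_left, map_sub, inner_self_eq_norm_sq, Complex.conj_ofReal,
      show RCLike.re ((c : ℂ) * inner ℂ y x) = c * RCLike.re (inner ℂ y x) by simp] at h3
    rw [inner_sub_left, map_sub, inner_self_eq_norm_sq] at h2
    have h10 : RCLike.re (inner ℂ y x) ≤ (1 + (t : ℝ) ^ 2) * ‖x‖ ^ 2 := by
      have := inv_mul_le_iff₀ (show (0 : ℝ) < 1 + (t : ℝ) ^ 2 by positivity) |>.1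
        (show (1 + (t : ℝ) ^ 2)⁻¹ * RCLike.re (inner ℂ y x) ≤ ‖x‖ ^ 2 by rw [← hc]; linarith)
      exact this
    refine le_of_sq_le_sq ?_ (by positivity)
    nlinarith
  · intro x hx hx0
    have hbx := hran _ hx
    have hpx : b⁺ (x : H) ≠ 0 := fun h => hx0 (hx ▸ (hker _).2 h)
    have hpos : 0 < RCLike.re (inner ℂ (b⁺ (x : H)) (x : H)) := by
      refine lt_of_le_of_ne (hp.re_inner_nonneg_left _) fun h0 => hpx ?_
      have hq : CFC.sqrt b⁺ * CFC.sqrt b⁺ = b⁺ := CFC.sqrt_mul_sqrt_self _ (CFC.posPart_nonneg b)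
      have hqp := (ContinuousLinearMap.nonneg_iff_isPositive _).1 (CFC.sqrt_nonneg b⁺)
      have hqx : CFC.sqrt b⁺ (CFC.sqrt b⁺ (x : H)) = b⁺ (x : H) := congrArg (· (x : H)) hq
      rw [← hqx, hqp.inner_left_eq_inner_right, inner_self_eq_norm_sq] at h0
      have h1 : CFC.sqrt b⁺ (x : H) = 0 := by
        simpa using pow_eq_zero_iff (two_ne_zero) |>.1 h0.symm
      rw [← hqx, h1, map_zero]
    obtain ⟨h, h', he⟩ := resolventSq_spec ha hd (x : H)
    simp only [← hR] at h h' he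
    rw [← eq_sub_iff_add_eq'] at he
    set w : a.domain := ⟨R x, h⟩ with hw
    have hf : ∀ v : a.domain, inner ℂ ((x : H) - R x) (v : H) = inner ℂ (a w) (a v) := by
      intro v
      rw [← he]
      exact LinearPMap.adjoint_isFormalAdjoint hd ⟨a w, h'⟩ v
    have hf1 := congrArg RCLike.re (hf x)
    have hf2 := congrArg RCLike.re (hf w)
    have hwR : (w : H) = R x := rfl
    rw [inner_sub_left, map_sub, inner_self_eq_norm_sq] at hf1
    rw [inner_self_eq_norm_sq, hwR, inner_sub_left, map_sub, inner_self_eq_norm_sq,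
      inner_re_symm] at hf2
    have hr : RCLike.re (inner ℂ (R (x : H)) (x : H)) < c * ‖(x : H)‖ ^ 2 := by
      rw [hRx, hbx, add_zero, inner_sub_left, inner_smul_left, map_sub, Complex.conj_ofReal,
        show RCLike.re ((c : ℂ) * inner ℂ (x : H) (x : H)) =
          c * RCLike.re (inner ℂ (x : H) (x : H)) by simp, inner_self_eq_norm_sq]
      linarith
    have h1 := norm_sub_sq (𝕜 := ℂ) (R (x : H)) ((c : ℂ) • (x : H))
    have h2 := norm_sub_sq (𝕜 := ℂ) (a w) ((c : ℂ) • a x)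
    have hcs : ∀ u v : H, RCLike.re (inner ℂ u ((c : ℂ) • v)) = c * RCLike.re (inner ℂ u v) := by
      intro u v
      rw [inner_smul_right]
      simp
    have hcn : ∀ v : H, ‖(c : ℂ) • v‖ = c * ‖v‖ := by
      intro v
      rw [norm_smul, Complex.norm_real, Real.norm_of_nonneg hc0.le]
    rw [hcs, hcn] at h1 h2
    have h3 := sq_nonneg ‖R (x : H) - (c : ℂ) • (x : H)‖
    have h4 := sq_nonneg ‖a w - (c : ℂ) • a x‖
    have h5 : 0 < c * (c * (‖(x : H)‖ ^ 2 + ‖a x‖ ^ 2) - ‖(x : H)‖ ^ 2) := by nlinarith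
    have h6 := (mul_pos_iff_of_pos_left hc0).1 h5
    have h7 : (1 + (t : ℝ) ^ 2) * ‖(x : H)‖ ^ 2 < ‖(x : H)‖ ^ 2 + ‖a x‖ ^ 2 := by
      have h8 : c * (1 + (t : ℝ) ^ 2) = 1 := inv_mul_cancel₀ (by positivity)
      have h9 := mul_lt_mul_of_pos_left (sub_pos.1 h6)
        (show (0 : ℝ) < 1 + (t : ℝ) ^ 2 by positivity)
      rwa [← mul_assoc, mul_comm _ c, h8, one_mul] at h9
    refine lt_of_pow_lt_pow_left₀ 2 (norm_nonneg _) ?_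
    rw [mul_pow]
    linarith

end TauMeasurable

end

noncomputable section

namespace TauMeasurable

section Operators

variable {H : Type*} [NormedAddCommGroup H] [InnerProductSpace ℂ H] [CompleteSpace H]

/-! ### The spectral projections of an affiliated operator -/

/-! The statement is really about a nonincreasing function f = λ_a and its generalized inverse μ_a.
Up to strictness, μ(t) > s and f(s) > t say the same thing. For t < 1, log μ(t) / log(1/t) > q means
μ(t) > t^(-q). Setting s = t^(-q), so t = s^(-1/q), this gives f(s) > s^(-1/q), hence log f(s) /
log(1/s) < 1/q because log(1/s) < 0. So lower bounds q for the order of μ turn into upper bounds 1/q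
for the quotient of f, and conversely; the same substitution exchanges t → ∞ with s → 0. Loss of
strictness is harmless, since liminf and limsup are tested against all real q
(`eq_recip_of_forall`).

Operator theory supplies three facts: λ_a is nonincreasing (`distribution_antitone`), finite
somewhere (measurability), and positive at some s > 0 (`exists_distribution_pos`, from a ≠ 0 and
faithfulness). The last two, with monotonicity, make both sides nonnegative, which matters because
inversion reverses order only on [0, ∞]. -/

/-- Invariance under both y and y* makes K reducing: y maps the component of x orthogonal to K to a
vector still orthogonal to K, as seen by moving y to the other side as y*. -/
theorem commute_starProjection_of_invariant {K : Submodule ℂ H} [CompleteSpace K] {y : H →L[ℂ] H}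
    (hy : ∀ x ∈ K, y x ∈ K) (hy' : ∀ x ∈ K, star y x ∈ K) : Commute K.starProjection y := by
  refine ContinuousLinearMap.ext fun x => ?_
  change K.starProjection (y x) = y (K.starProjection x)
  refine Submodule.eq_starProjection_of_mem_of_inner_eq_zero
    (hy _ (Submodule.starProjection_apply_mem _ _)) fun w hw => ?_
  rw [← map_sub, ← ContinuousLinearMap.adjoint_inner_right]
  exact Submodule.starProjection_inner_eq_zero (K := K) x _ (hy' w hw)

theorem commute_posSpectralProj {b y : H →L[ℂ] H} (hy : Commute b y)
    (hy' : Commute b (star y)) : Commute (posSpectralProj b) y := by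
  have key : ∀ z : H →L[ℂ] H, Commute b z → ∀ x ∈ b⁺.range.topologicalClosure,
      z x ∈ b⁺.range.topologicalClosure := by
    intro z hz
    have hc : Commute b⁺ z := hz.cfcₙ_real _
    have hle : b⁺.range.topologicalClosure ≤
        (b⁺.range.topologicalClosure).comap (z : H →ₗ[ℂ] H) := by
      refine Submodule.topologicalClosure_minimal _ ?_
        (b⁺.range.isClosed_topologicalClosure.preimage z.continuous)
      rintro _ ⟨x, rfl⟩
      exact Submodule.le_topologicalClosure _ ⟨z x, DFunLike.congr_fun hc x⟩
    exact hle
  exact commute_starProjection_of_invariant (key y hy) (key _ hy')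

variable {M : VonNeumannAlgebra H}

theorem mem_of_commute_commutant {b : H →L[ℂ] H} (h : ∀ y ∈ M.commutant, Commute b y) :
    b ∈ M := by
  rw [← M.commutant_commutant, VonNeumannAlgebra.mem_commutant_iff]
  exact fun y hy => (h y hy).symm.eq

theorem commute_of_mem_commutant {b y : H →L[ℂ] H} (hb : b ∈ M) (hy : y ∈ M.commutant) :
    Commute b y :=
  VonNeumannAlgebra.mem_commutant_iff.1 hy b hb

theorem posSpectralProj_mem {b : H →L[ℂ] H} (hb : b ∈ M) : posSpectralProj b ∈ M :=
  mem_of_commute_commutant fun _ hy => commute_posSpectralProj (commute_of_mem_commutant hb hy)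
    (commute_of_mem_commutant hb (star_mem hy))

/-- Affiliation in graph form: y ⊕ y preserves the graph for y in the commutant. -/
theorem IsAffiliated.map_mem_hilbertGraph {a : H →ₗ.[ℂ] H} (ha : a.IsClosed)
    (haM : IsAffiliated M a) {y : H →L[ℂ] H} (hy : y ∈ M.commutant) {z : WithLp 2 (H × H)}
    (hz : z ∈ hilbertGraph a) : WithLp.toLp 2 (y z.fst, y z.snd) ∈ hilbertGraph a := by
  rw [mem_hilbertGraph ha] at hz ⊢
  obtain ⟨x, hx1, hx2⟩ := (LinearPMap.mem_graph_iff a).1 hz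
  obtain ⟨h, he⟩ := haM y hy x
  rw [LinearPMap.mem_graph_iff]
  refine ⟨⟨y x, h⟩, ?_, ?_⟩
  · exact congrArg y hx1
  · exact he.trans (congrArg y hx2)

/-- The graph is invariant under y ⊕ y and its adjoint, so the graph projection commutes with y ⊕ y.
Its upper left corner then commutes with y, and the double commutant theorem applies. -/
theorem IsAffiliated.resolventSq_mem {a : H →ₗ.[ℂ] H} (ha : a.IsClosed)
    (haM : IsAffiliated M a) : resolventSq a ∈ M := by
  refine mem_of_commute_commutant fun y hy => ContinuousLinearMap.ext fun x => ?_
  set p := (hilbertGraph a).starProjection (WithLp.toLp 2 (x, 0)) with hp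
  have hpm : p ∈ hilbertGraph a := Submodule.starProjection_apply_mem _ _
  have key : (WithLp.toLp 2 (y p.fst, y p.snd) : WithLp 2 (H × H)) =
      (hilbertGraph a).starProjection (WithLp.toLp 2 (y x, 0)) := by
    refine (Submodule.eq_starProjection_of_mem_of_inner_eq_zero
      (haM.map_mem_hilbertGraph ha hy hpm) fun w hw => ?_).symm
    have h0 := Submodule.starProjection_inner_eq_zero (K := hilbertGraph a)
      (WithLp.toLp 2 (x, 0)) _ (haM.map_mem_hilbertGraph ha (star_mem hy) hw)
    rw [← hp, WithLp.prod_inner_apply] at h0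
    rw [WithLp.prod_inner_apply]
    simp only [WithLp.ofLp_sub, Prod.fst_sub, Prod.snd_sub, zero_sub, inner_neg_left,
      ContinuousLinearMap.star_eq_adjoint, ContinuousLinearMap.adjoint_inner_right,
      map_sub, map_neg] at h0 ⊢
    exact h0
  exact (congrArg (fun z : WithLp 2 (H × H) => z.fst) key).symm

theorem absSpectralProj_mem {a : H →ₗ.[ℂ] H} (ha : a.IsClosed) (haM : IsAffiliated M a)
    (t : ℝ≥0) : absSpectralProj a t ∈ M :=
  posSpectralProj_mem (sub_mem (M.toStarSubalgebra.smul_mem (one_mem M) _) (haM.resolventSq_mem ha))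

theorem commute_absSpectralProj {a : H →ₗ.[ℂ] H} (ha : a.IsClosed)
    (hd : Dense (a.domain : Set H)) (s t : ℝ≥0) :
    Commute (absSpectralProj a s) (absSpectralProj a t) := by
  obtain ⟨hP, hc, -, -⟩ := absSpectralProj_spec ha hd t
  have h : Commute ((((1 + (s : ℝ) ^ 2)⁻¹ : ℝ) : ℂ) • (1 : H →L[ℂ] H) - resolventSq a)
      (absSpectralProj a t) := ((Commute.one_left _).smul_left _).sub_left hc.symm
  exact commute_posSpectralProj h (hP.isSelfAdjoint.star_eq.symm ▸ h)

theorem absSpectralProj_mul_of_le {a : H →ₗ.[ℂ] H} (ha : a.IsClosed)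
    (hd : Dense (a.domain : Set H)) {s t : ℝ≥0} (hst : s ≤ t) :
    absSpectralProj a s * absSpectralProj a t = absSpectralProj a t := by
  obtain ⟨hPs, -, hs, -⟩ := absSpectralProj_spec ha hd s
  obtain ⟨hPt, -, -, ht⟩ := absSpectralProj_spec ha hd t
  have hc := commute_absSpectralProj ha hd s t
  refine ContinuousLinearMap.ext fun x => ?_
  -- Here u = (1 - e_s) e_t x lies in the kernel of e_s and the range of e_t, so u ≠ 0 would give
  -- t‖u‖ < ‖a u‖ ≤ s‖u‖.
  set u := absSpectralProj a t x - absSpectralProj a s (absSpectralProj a t x) with hu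
  have hus : absSpectralProj a s u = 0 := by
    rw [hu, map_sub, sub_eq_zero]
    exact (DFunLike.congr_fun hPs.isIdempotentElem.eq _).symm
  have hut : absSpectralProj a t u = u := by
    have h1 : absSpectralProj a t (absSpectralProj a t x) = absSpectralProj a t x :=
      DFunLike.congr_fun hPt.isIdempotentElem.eq x
    have h2 : absSpectralProj a s (absSpectralProj a t (absSpectralProj a t x)) =
        absSpectralProj a t (absSpectralProj a s (absSpectralProj a t x)) :=
      DFunLike.congr_fun hc (absSpectralProj a t x)
    rw [hu, map_sub, ← h2, h1]
  obtain ⟨h, hle⟩ := hs u hus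
  have hu0 : u = 0 := by
    by_contra hne
    exact absurd (ht ⟨u, h⟩ hut hne)
      (not_lt.2 (hle.trans (mul_le_mul_of_nonneg_right (NNReal.coe_le_coe.2 hst) (norm_nonneg _))))
  exact (sub_eq_zero.1 hu0).symm

/-! ### The distribution function -/

theorem NSFTrace.mono (tr : NSFTrace M) {x y : H →L[ℂ] H} (hx : x ∈ M) (hy : y ∈ M)
    (hx0 : 0 ≤ x) (hxy : x ≤ y) : tr x ≤ tr y := by
  have h := tr.map_add' x hx (y - x) (sub_mem hy hx) hx0 (sub_nonneg.2 hxy)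
  rw [add_sub_cancel] at h
  exact h ▸ le_self_add

theorem distribution_antitone {tr : NSFTrace M} {a : H →ₗ.[ℂ] H} (ha : IsMeasurableOp tr a) :
    Antitone (distribution tr a) := by
  intro s t hst
  have hPs := (absSpectralProj_spec ha.closed ha.dense s).1
  have hPt := (absSpectralProj_spec ha.closed ha.dense t).1
  have h1 := absSpectralProj_mul_of_le ha.closed ha.dense hst
  have h2 : absSpectralProj a t * absSpectralProj a s = absSpectralProj a t :=
    (commute_absSpectralProj ha.closed ha.dense s t).symm.eq.trans h1
  refine tr.mono (absSpectralProj_mem ha.closed ha.affiliated t)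
    (absSpectralProj_mem ha.closed ha.affiliated s) hPt.nonneg (sub_nonneg.1 ?_)
  -- The difference e_s - e_t of nested projections is itself a projection, hence positive.
  refine IsStarProjection.nonneg ⟨?_, hPs.isSelfAdjoint.sub hPt.isSelfAdjoint⟩
  rw [IsIdempotentElem, sub_mul, mul_sub, mul_sub, h1, h2, hPs.isIdempotentElem.eq,
    hPt.isIdempotentElem.eq]
  abel

/-- Otherwise faithfulness kills e_{|a|}(s, ∞) for all s > 0, so a is everywhere defined with ‖a x‖
≤ s‖x‖ for every s > 0, forcing a = 0. -/
theorem exists_distribution_pos {tr : NSFTrace M} {a : H →ₗ.[ℂ] H} (ha : IsMeasurableOp tr a)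
    (ha0 : a ≠ 0) : ∃ s : ℝ≥0, 0 < s ∧ 0 < distribution tr a s := by
  by_contra! hcon
  have hP : ∀ s : ℝ≥0, 0 < s → absSpectralProj a s = 0 := fun s hs =>
    tr.faithful' _ (absSpectralProj_mem ha.closed ha.affiliated s)
      (absSpectralProj_spec ha.closed ha.dense s).1.nonneg (nonpos_iff_eq_zero.1 (hcon s hs))
  have hbound : ∀ x, ∃ h : x ∈ a.domain, ∀ s : ℝ≥0, 0 < s → ‖a ⟨x, h⟩‖ ≤ s * ‖x‖ := by
    intro x
    have h : ∀ s : ℝ≥0, 0 < s → ∃ h : x ∈ a.domain, ‖a ⟨x, h⟩‖ ≤ s * ‖x‖ := fun s hs =>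
      (absSpectralProj_spec ha.closed ha.dense s).2.2.1 x (by rw [hP s hs]; rfl)
    exact ⟨(h 1 one_pos).1, fun s hs => (h s hs).2⟩
  have hzero : ∀ x (h : x ∈ a.domain), a ⟨x, h⟩ = 0 := by
    intro x h
    by_contra hne
    have hn : 0 < ‖a ⟨x, h⟩‖ := norm_pos_iff.2 hne
    have hx : 0 < ‖x‖ + 1 := by positivity
    obtain ⟨_, hb⟩ := hbound x
    -- The `+ 1` in the denominator avoids treating x = 0 separately.
    have := hb (⟨‖a ⟨x, h⟩‖ / (‖x‖ + 1), by positivity⟩) (div_pos hn hx)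
    change _ ≤ ‖a ⟨x, h⟩‖ / (‖x‖ + 1) * ‖x‖ at this
    rw [div_mul_eq_mul_div, le_div_iff₀ hx] at this
    linarith
  -- The zero partial map has full domain, so equality of domains must be proved too.
  refine ha0 (LinearPMap.ext ?_ fun x hx hx' => ?_)
  · exact eq_top_iff.2 fun x _ => (hbound x).1
  · exact hzero x hx

end Operators

/-! ### Comparison of `logRatio` with a real number -/

theorem mul_log_inv_eq_log_rpow (x : ℝ≥0) (hx : 0 < x) (q : ℝ) :
    (q : EReal) * ((Real.log (1 / (x : ℝ)) : ℝ) : EReal) =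
      ENNReal.log ((x ^ (-q) : ℝ≥0) : ℝ≥0∞) := by
  rw [ENNReal.log_of_nnreal (NNReal.rpow_pos hx).ne', NNReal.coe_rpow,
    Real.log_rpow (NNReal.coe_pos.2 hx), one_div, Real.log_inv, ← EReal.coe_mul]
  congr 1
  ring

theorem strictMono_logRatio {x : ℝ≥0} (hx : 0 < x) (hx1 : x < 1) :
    StrictMono fun y => logRatio y x := by
  have h : (0 : EReal) < ((Real.log (1 / (x : ℝ)) : ℝ) : EReal) := by
    rw [one_div, Real.log_inv, EReal.coe_pos, neg_pos]
    exact Real.log_neg (NNReal.coe_pos.2 hx) (by exact_mod_cast hx1)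
  exact (EReal.strictMono_div_right_of_pos h (EReal.coe_ne_top _)).comp ENNReal.log_strictMono

theorem strictAnti_logRatio {x : ℝ≥0} (hx1 : 1 < x) : StrictAnti fun y => logRatio y x := by
  have h : ((Real.log (1 / (x : ℝ)) : ℝ) : EReal) < 0 := by
    rw [one_div, Real.log_inv, EReal.coe_neg', neg_lt_zero]
    exact Real.log_pos (by exact_mod_cast hx1)
  exact (EReal.strictAnti_div_right_of_neg h (EReal.coe_ne_bot _)).comp_strictMono
    ENNReal.log_strictMono

/-- Powers are the yardstick: with strict monotonicity in y, comparing the quotient with q amounts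
to comparing y with x^(-q). -/
theorem logRatio_rpow {x : ℝ≥0} (hx : 0 < x) (hx1 : x ≠ 1) (q : ℝ) :
    logRatio ((x ^ (-q) : ℝ≥0) : ℝ≥0∞) x = q := by
  rw [logRatio, ← mul_log_inv_eq_log_rpow x hx, ← EReal.mul_div_right,
    EReal.div_mul_cancel (EReal.coe_ne_bot _) (EReal.coe_ne_top _)]
  rw [one_div, Real.log_inv, EReal.coe_ne_zero, neg_ne_zero]
  exact Real.log_ne_zero_of_pos_of_ne_one (NNReal.coe_pos.2 hx) (by exact_mod_cast hx1)

section Comparison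

variable {x : ℝ≥0} {y : ℝ≥0∞} {q : ℝ}

theorem lt_logRatio_iff_of_lt_one (hx : 0 < x) (hx1 : x < 1) :
    (q : EReal) < logRatio y x ↔ ((x ^ (-q) : ℝ≥0) : ℝ≥0∞) < y := by
  rw [← logRatio_rpow hx hx1.ne q]
  exact (strictMono_logRatio hx hx1).lt_iff_lt

theorem logRatio_lt_iff_of_lt_one (hx : 0 < x) (hx1 : x < 1) :
    logRatio y x < (q : EReal) ↔ y < ((x ^ (-q) : ℝ≥0) : ℝ≥0∞) := by
  rw [← logRatio_rpow hx hx1.ne q]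
  exact (strictMono_logRatio hx hx1).lt_iff_lt

theorem lt_logRatio_iff_of_one_lt (hx1 : 1 < x) :
    (q : EReal) < logRatio y x ↔ y < ((x ^ (-q) : ℝ≥0) : ℝ≥0∞) := by
  rw [← logRatio_rpow (one_pos.trans hx1) hx1.ne' q]
  exact (strictAnti_logRatio hx1).lt_iff_gt

theorem logRatio_lt_iff_of_one_lt (hx1 : 1 < x) :
    logRatio y x < (q : EReal) ↔ ((x ^ (-q) : ℝ≥0) : ℝ≥0∞) < y := by
  rw [← logRatio_rpow (one_pos.trans hx1) hx1.ne' q]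
  exact (strictAnti_logRatio hx1).lt_iff_gt

end Comparison

/-! ### Filters on the nonnegative reals -/

theorem eventually_pos_lt_one : ∀ᶠ x : ℝ≥0 in 𝓝[>] 0, 0 < x ∧ x < 1 :=
  (eventually_mem_nhdsWithin).and
    (eventually_nhdsWithin_of_eventually_nhds (gt_mem_nhds one_pos))

theorem tendsto_rpow_neg_atTop {q : ℝ} (hq : 0 < q) :
    Tendsto (fun x : ℝ≥0 => x ^ (-q)) atTop (𝓝[>] 0) := by
  refine tendsto_nhdsWithin_iff.2 ⟨?_, ?_⟩
  · rw [← NNReal.tendsto_coe]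
    simpa using! (_root_.tendsto_rpow_neg_atTop hq).comp (NNReal.tendsto_coe_atTop.2 tendsto_id)
  · filter_upwards [eventually_gt_atTop 0] with x hx using NNReal.rpow_pos hx

theorem tendsto_rpow_neg_nhdsGT {q : ℝ} (hq : 0 < q) :
    Tendsto (fun x : ℝ≥0 => x ^ (-q)) (𝓝[>] 0) atTop := by
  rw [← NNReal.tendsto_coe_atTop]
  have h : Tendsto (fun x : ℝ≥0 => (x : ℝ)) (𝓝[>] 0) (𝓝[>] 0) :=
    tendsto_nhdsWithin_iff.2 ⟨(NNReal.continuous_coe.tendsto' 0 0 rfl).mono_left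
      nhdsWithin_le_nhds, eventually_mem_nhdsWithin.mono fun x hx => NNReal.coe_pos.2 hx⟩
  simpa using! (tendsto_rpow_neg_nhdsGT_zero (neg_neg_of_pos hq)).comp h

theorem rpow_neg_rpow_neg_inv {q : ℝ} (hq : q ≠ 0) (x : ℝ≥0) : (x ^ (-q)) ^ (-q⁻¹) = x := by
  rw [← NNReal.rpow_mul, neg_mul_neg, mul_inv_cancel₀ hq, NNReal.rpow_one]

/-! ### Orders of a nonincreasing function and of its generalized inverse -/

/-- Weak inequalities at real test points suffice by density of the reals in `EReal`. The values U =
0 and U = ∞ are handled apart. -/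
theorem eq_recip_of_forall {L U : EReal} (hL : 0 ≤ L) (hU : 0 ≤ U)
    (h1 : ∀ q : ℝ, 0 < q → (q : EReal) < L → U ≤ ((q⁻¹ : ℝ) : EReal))
    (h2 : ∀ q : ℝ, 0 < q → U < (q : EReal) → ((q⁻¹ : ℝ) : EReal) ≤ L) : L = recip U := by
  have hUnb : U ≠ ⊥ := fun h => by simp [h] at hU
  induction U with
  | bot => exact absurd rfl hUnb
  | top =>
    rw [recip, if_neg EReal.top_ne_zero, EReal.inv_top]
    refine le_antisymm (not_lt.1 fun h => ?_) hL
    obtain ⟨q, hq0, hqL⟩ := EReal.lt_iff_exists_real_btwn.1 h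
    exact absurd (h1 q (EReal.coe_pos.1 hq0) hqL) (not_le.2 (EReal.coe_lt_top _))
  | coe u =>
    have hu : 0 ≤ u := EReal.coe_nonneg.1 hU
    rcases hu.eq_or_lt with rfl | hu
    · rw [recip, if_pos EReal.coe_zero]
      refine EReal.eq_top_iff_forall_lt _ |>.2 fun y => ?_
      have hy : (0 : ℝ) < |y| + 1 := by positivity
      -- With U = 0 every positive q is admissible; this one forces L ≥ |y| + 1 > y.
      have := h2 (|y| + 1)⁻¹ (inv_pos.2 hy) (EReal.coe_lt_coe_iff.2 (inv_pos.2 hy))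
      rw [inv_inv] at this
      exact lt_of_lt_of_le (EReal.coe_lt_coe_iff.2 (by linarith [le_abs_self y])) this
    · rw [recip, if_neg (by exact_mod_cast hu.ne'), ← EReal.coe_inv]
      refine le_antisymm (not_lt.1 fun h => ?_) (not_lt.1 fun h => ?_)
      · obtain ⟨q, hq, hqL⟩ := EReal.lt_iff_exists_real_btwn.1 h
        rw [EReal.coe_lt_coe_iff] at hq
        have hle := EReal.coe_le_coe_iff.1 (h1 q ((inv_pos.2 hu).trans hq) hqL)
        exact absurd (inv_lt_of_inv_lt₀ hu hq) (not_lt.2 hle)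
      · obtain ⟨q, hLq, hq⟩ := EReal.lt_iff_exists_real_btwn.1 h
        rw [EReal.coe_lt_coe_iff] at hq
        have hq0 : 0 < q := EReal.coe_pos.1 (hL.trans_lt hLq)
        have hle := h2 q⁻¹ (inv_pos.2 hq0)
          (EReal.coe_lt_coe_iff.2 ((lt_inv_comm₀ hu hq0).2 hq))
        rw [inv_inv] at hle
        exact not_lt.2 hle hLq

section Orders

variable {f : ℝ≥0 → ℝ≥0∞}

/-- The generalized inverse `t ↦ inf {s ≥ 0 : f s ≤ t}`. -/
def generalizedInverse (f : ℝ≥0 → ℝ≥0∞) (t : ℝ≥0) : ℝ≥0∞ :=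
  ⨅ (s : ℝ≥0) (_ : f s ≤ (t : ℝ≥0∞)), (s : ℝ≥0∞)

theorem lt_of_coe_lt_generalizedInverse {s t : ℝ≥0} (h : (s : ℝ≥0∞) < generalizedInverse f t) :
    (t : ℝ≥0∞) < f s :=
  not_le.1 fun hle => not_le.2 h (iInf₂_le s hle)

theorem generalizedInverse_le {s t : ℝ≥0} (h : f s ≤ t) : generalizedInverse f t ≤ s :=
  iInf₂_le s h

/-- By monotonicity no s' < s can satisfy f s' ≤ t. The conclusion is only weak because f is not
assumed right-continuous. -/
theorem le_generalizedInverse (hf : Antitone f) {s t : ℝ≥0} (h : (t : ℝ≥0∞) < f s) :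
    (s : ℝ≥0∞) ≤ generalizedInverse f t :=
  le_iInf₂ fun _ hs' => ENNReal.coe_le_coe.2 <| le_of_not_gt fun hlt =>
    absurd (h.trans_le (hf hlt.le)) (not_lt.2 hs')

theorem le_of_generalizedInverse_lt (hf : Antitone f) {s t : ℝ≥0}
    (h : generalizedInverse f t < s) : f s ≤ t :=
  not_lt.1 fun hlt => not_le.2 h (le_generalizedInverse hf hlt)

/-- `liminf` bound from strict real lower bounds. -/
theorem le_liminf_of_forall_real_lt {α : Type*} {F : Filter α} {u : α → EReal} {c : ℝ}
    (h : ∀ q : ℝ, q < c → ∀ᶠ x in F, (q : EReal) < u x) : (c : EReal) ≤ liminf u F := by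
  refine le_of_forall_lt fun d hd => ?_
  obtain ⟨q, hdq, hqc⟩ := EReal.lt_iff_exists_real_btwn.1 hd
  exact hdq.trans_le (le_liminf_of_le (h := (h q (EReal.coe_lt_coe_iff.1 hqc)).mono fun _ => le_of_lt))

theorem liminf_nonneg_of_forall_neg_lt {α : Type*} {F : Filter α} {u : α → EReal}
    (h : ∀ q : ℝ, 0 < q → ∀ᶠ x in F, ((-q : ℝ) : EReal) < u x) : 0 ≤ liminf u F :=
  le_liminf_of_forall_real_lt (c := 0) fun q hq => by simpa using h (-q) (neg_pos.2 hq)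

/-- For every q > 0, x^q tends to 0 and so drops below c, which puts the quotient above -q. -/
theorem liminf_logRatio_nonneg_nhdsGT {g : ℝ≥0 → ℝ≥0∞} {c : ℝ≥0∞} (hc : 0 < c)
    (hg : ∀ᶠ x in 𝓝[>] 0, c ≤ g x) : 0 ≤ liminf (fun x => logRatio (g x) x) (𝓝[>] 0) := by
  refine liminf_nonneg_of_forall_neg_lt fun q hq => ?_
  have ht : Tendsto (fun x : ℝ≥0 => ((x ^ q : ℝ≥0) : ℝ≥0∞)) (𝓝[>] 0) (𝓝 0) := by
    refine ENNReal.tendsto_coe.2 (Tendsto.mono_left ?_ nhdsWithin_le_nhds)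
    exact (NNReal.continuous_rpow_const hq.le).tendsto' 0 0 (NNReal.zero_rpow hq.ne')
  filter_upwards [hg, eventually_pos_lt_one, ht.eventually_lt_const hc] with x h1 ⟨h2, h3⟩ h4
  rw [lt_logRatio_iff_of_lt_one h2 h3, neg_neg]
  exact h4.trans_le h1

theorem liminf_logRatio_nonneg_atTop {g : ℝ≥0 → ℝ≥0∞} {c : ℝ≥0∞} (hc : c < ⊤)
    (hg : ∀ᶠ x in atTop, g x ≤ c) : 0 ≤ liminf (fun x => logRatio (g x) x) atTop := by
  refine liminf_nonneg_of_forall_neg_lt fun q hq => ?_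
  lift c to ℝ≥0 using hc.ne
  have ht : Tendsto (fun x : ℝ≥0 => x ^ q) atTop atTop := NNReal.tendsto_rpow_atTop hq
  filter_upwards [hg, eventually_gt_atTop 1, ht.eventually_gt_atTop c] with x h1 h2 h3
  rw [lt_logRatio_iff_of_one_lt h2, neg_neg]
  exact h1.trans_lt (ENNReal.coe_lt_coe.2 h3)

theorem liminf_generalizedInverse_nhdsGT_eq (hf : Antitone f) {s₀ s₁ : ℝ≥0}
    (hs₀ : f s₀ < ⊤) (hs₁ : 0 < s₁) (hs₁' : 0 < f s₁) :
    liminf (fun t => logRatio (generalizedInverse f t) t) (𝓝[>] 0) =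
      recip (limsup (fun s => logRatio (f s) s) atTop) := by
  refine eq_recip_of_forall (liminf_logRatio_nonneg_nhdsGT (ENNReal.coe_pos.2 hs₁) ?_)
    ((liminf_logRatio_nonneg_atTop hs₀ ?_).trans liminf_le_limsup) (fun q hq h => ?_)
    (fun q hq h => ?_)
  · have ht : Tendsto (fun x : ℝ≥0 => (x : ℝ≥0∞)) (𝓝[>] 0) (𝓝 0) :=
      ENNReal.tendsto_coe.2 (tendsto_id.mono_left nhdsWithin_le_nhds)
    filter_upwards [ht.eventually_lt_const hs₁'] with t h using le_generalizedInverse hf h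
  · filter_upwards [eventually_ge_atTop s₀] with s h using hf h
  -- Take t = s^(-1/q) → 0: then μ(t) > t^(-q) = s, so f(s) > t = s^(-1/q).
  · have hev := (tendsto_rpow_neg_atTop (inv_pos.2 hq)).eventually
      ((eventually_lt_of_lt_liminf h).and eventually_pos_lt_one)
    refine limsup_le_of_le (h := ?_)
    filter_upwards [hev, eventually_gt_atTop 1] with s ⟨h1, h2, h3⟩ hs
    rw [lt_logRatio_iff_of_lt_one h2 h3] at h1
    have h4 := rpow_neg_rpow_neg_inv (inv_ne_zero hq.ne') s
    rw [inv_inv] at h4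
    rw [h4] at h1
    exact ((logRatio_lt_iff_of_one_lt hs).2 (lt_of_coe_lt_generalizedInverse h1)).le
  -- Take s = t^(-1/q) → ∞: then f(s) > s^(-q) = t, so μ(t) ≥ s = t^(-1/q).
  · have hev := (tendsto_rpow_neg_nhdsGT (inv_pos.2 hq)).eventually
      ((eventually_lt_of_limsup_lt h).and (eventually_gt_atTop 1))
    refine le_liminf_of_le (h := ?_)
    filter_upwards [hev, eventually_pos_lt_one] with t ⟨h1, h2⟩ ⟨ht, ht1⟩
    rw [logRatio_lt_iff_of_one_lt h2] at h1
    have h4 := rpow_neg_rpow_neg_inv (inv_ne_zero hq.ne') t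
    rw [inv_inv] at h4
    rw [h4] at h1
    refine not_lt.1 fun hlt => ?_
    rw [logRatio_lt_iff_of_lt_one ht ht1] at hlt
    exact not_le.2 hlt (le_generalizedInverse hf h1)

theorem liminf_generalizedInverse_atTop_eq (hf : Antitone f) {s₀ s₁ : ℝ≥0}
    (hs₀ : f s₀ < ⊤) (hs₁ : 0 < s₁) (hs₁' : 0 < f s₁) :
    liminf (fun t => logRatio (generalizedInverse f t) t) atTop =
      recip (limsup (fun s => logRatio (f s) s) (𝓝[>] 0)) := by
  refine eq_recip_of_forall
    (liminf_logRatio_nonneg_atTop (ENNReal.coe_lt_top (r := s₀)) ?_)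
    ((liminf_logRatio_nonneg_nhdsGT hs₁' ?_).trans liminf_le_limsup) (fun q hq h => ?_)
    (fun q hq h => ?_)
  · filter_upwards [eventually_ge_atTop (f s₀).toNNReal] with t h
    refine generalizedInverse_le ?_
    rw [← ENNReal.coe_toNNReal hs₀.ne]
    exact ENNReal.coe_le_coe.2 h
  · filter_upwards [eventually_nhdsWithin_of_eventually_nhds (gt_mem_nhds hs₁)] with s h
    exact hf (le_of_lt h)
  -- Now t = s^(-1/q) → ∞, and log(1/t) < 0 flips the inequality: μ(t) < t^(-q) = s, so f(s) ≤ t.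
  · have hev := (tendsto_rpow_neg_nhdsGT (inv_pos.2 hq)).eventually
      ((eventually_lt_of_lt_liminf h).and (eventually_gt_atTop 1))
    refine limsup_le_of_le (h := ?_)
    filter_upwards [hev, eventually_pos_lt_one] with s ⟨h1, h2⟩ ⟨hs, hs1⟩
    rw [lt_logRatio_iff_of_one_lt h2] at h1
    have h4 := rpow_neg_rpow_neg_inv (inv_ne_zero hq.ne') s
    rw [inv_inv] at h4
    rw [h4] at h1
    refine not_lt.1 fun hlt => ?_
    rw [lt_logRatio_iff_of_lt_one hs hs1] at hlt
    exact not_le.2 hlt (le_of_generalizedInverse_lt hf h1)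
  -- With s = t^(-1/q) → 0, f(s) < s^(-q) = t gives μ(t) ≤ s.
  · have hev := (tendsto_rpow_neg_atTop (inv_pos.2 hq)).eventually
      ((eventually_lt_of_limsup_lt h).and eventually_pos_lt_one)
    refine le_liminf_of_le (h := ?_)
    filter_upwards [hev, eventually_gt_atTop 1] with t ⟨h1, h2, h3⟩ ht
    rw [logRatio_lt_iff_of_lt_one h2 h3] at h1
    have h4 := rpow_neg_rpow_neg_inv (inv_ne_zero hq.ne') t
    rw [inv_inv] at h4
    rw [h4] at h1
    refine not_lt.1 fun hlt => ?_
    rw [logRatio_lt_iff_of_one_lt ht] at hlt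
    exact not_le.2 hlt (generalizedInverse_le h1.le)

end Orders

end TauMeasurable

end

theorem mainTheorem8 {H : Type*} [NormedAddCommGroup H] [InnerProductSpace ℂ H]
    [CompleteSpace H] (M : VonNeumannAlgebra H) (tr : TauMeasurable.NSFTrace M)
    (a : H →ₗ.[ℂ] H) (ha : TauMeasurable.IsMeasurableOp tr a) (ha0 : a ≠ 0) :
    TauMeasurable.orderZero tr a =
        TauMeasurable.recip (limsup (fun s : ℝ≥0 =>
          TauMeasurable.logRatio (TauMeasurable.distribution tr a s) s) atTop) ∧
      TauMeasurable.orderInfty tr a =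
        TauMeasurable.recip (limsup (fun s : ℝ≥0 =>
          TauMeasurable.logRatio (TauMeasurable.distribution tr a s) s) (𝓝[>] 0)) := by
  obtain ⟨s₀, -, hs₀⟩ := ha.finite
  obtain ⟨s₁, hs₁, hs₁'⟩ := TauMeasurable.exists_distribution_pos ha ha0
  have hf := TauMeasurable.distribution_antitone ha
  -- `rearrangement` is definitionally the `generalizedInverse` of `distribution`.
  exact ⟨TauMeasurable.liminf_generalizedInverse_nhdsGT_eq hf hs₀ hs₁ hs₁',
    TauMeasurable.liminf_generalizedInverse_atTop_eq hf hs₀ hs₁ hs₁'⟩
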